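/- A Petri net with hierarchical inhibitor and transfer arcs consists of a finite set $P$ of places, a finite set $T$ of transitions, an initial marking $M_0:P\to\mathbb N$, a total ordering $\sqsubseteq$ of $P$ (the hierarchy), and a flow relation $F$ with $F(t,p)\in\mathbb N$ and $F(p,t)\in\mathbb N\cup\{I\}\cup\{S_q\mid q\in P\}$ for all $p\in P$, $t\in T$, such that whenever $F(p,t)\notin\mathbb N$, also $F(q,t)\notin\mathbb N$ for all $q\sqsubseteq p$. Here $F(p,t)=I$ denotes an inhibitor arc from $p$ to $t$, and $F(p,t)=S_q$ denotes a transfer arc from $p$ through $t$ to $q$. A transition $t$ is firable at a marking $M:P\to\mathbb N$ if, for every place $p$, $M(p)\ge F(p,t)$ when $F(p,t)\in\mathbb N$ and $M(p)=0$ when $F(p,t)=I$. Firing $t$ at $M$ gives the marking $M'$ with $$M'(p)=k_p+F(t,p)+\sum_{q\in P,\ F(q,t)=S_p}M(q),$$ where $k_p=M(p)-F(p,t)$ if $F(p,t)\in\mathbb N$, and $k_p=0$ if $F(p,t)$ is $I$ or some $S_q$ (in the latter case all tokens of $p$ are moved to $q$). Coverability is undecidable for these nets: there is no algorithm that, given such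 a net (as finite data) and a marking $M:P\to\mathbb N$, decides whether some marking $M'$ with $M'(p)\ge M(p)$ for all $p\in P$ is reachable from $M_0$ by a finite (possibly empty) sequence of transition firings. -/

import Mathlib

/-- The possible values of the flow relation on a pair (place, transition), for nets with inhibitor
and transfer arcs over the set of places `P`: an ordinary weight in `ℕ`, an inhibitor arc `I`, or a
transfer arc `S_q` into the place `q`. -/
inductive Arc (P : Type) : Type where
  | weight (k : ℕ) : Arc P
  | inhibitor : Arc P
  | transfer (q : P) : Arc P

/-- An arc is special if it is not an ordinary weight. -/
def Arc.IsSpecial {P : Type} (a : Arc P) : Prop := ∀ k : ℕ, a ≠ Arc.weight k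

/-- A Petri net with hierarchical inhibitor and transfer arcs, with places `P` and transitions
`T`. -/
structure HITPN (P T : Type) where
  /-- the flow relation on `P × T` -/
  pre : P → T → Arc P
  /-- the flow relation on `T × P` -/
  post : T → P → ℕ
  /-- the hierarchy: `below q p` means `q ⊑ p` -/
  below : P → P → Prop
  /-- the hierarchy is a total ordering of the places -/
  below_linear : IsLinearOrder P below
  /-- the special arcs respect the hierarchy -/
  hierarchical : ∀ (p : P) (t : T), (pre p t).IsSpecial →
    ∀ q : P, below q p → (pre q t).IsSpecial
  /-- the initial marking -/
  init : P → ℕ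

namespace HITPN

variable {P T : Type}

/-- The transition `t` is firable at the marking `M`. -/
def Firable (N : HITPN P T) (M : P → ℕ) (t : T) : Prop :=
  ∀ p : P, match N.pre p t with
    | Arc.weight k => k ≤ M p
    | Arc.inhibitor => M p = 0
    | Arc.transfer _ => True

/-- The tokens of `p` that stay in `p` when `t` fires at `M` (apart from tokens that `t` puts
there). -/
def kept (N : HITPN P T) (M : P → ℕ) (t : T) (p : P) : ℕ :=
  match N.pre p t with
    | Arc.weight k => M p - k
    | Arc.inhibitor => M p
    | Arc.transfer _ => 0

open Classical in
/-- The tokens that the transfer arcs of `t` move into `p` when `t` fires at `M`. -/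
noncomputable def transferred [Fintype P] (N : HITPN P T) (M : P → ℕ) (t : T) (p : P) : ℕ :=
  ∑ q : P, if N.pre q t = Arc.transfer p then M q else 0

/-- The marking obtained by firing `t` at `M` (all transfers take place simultaneously). -/
noncomputable def fire [Fintype P] (N : HITPN P T) (M : P → ℕ) (t : T) : P → ℕ :=
  fun p => N.kept M t p + N.post t p + N.transferred M t p

/-- One step of a run: some firable transition leads from `M` to `M'`. -/
def Step [Fintype P] (N : HITPN P T) (M M' : P → ℕ) : Prop :=
  ∃ t : T, N.Firable M t ∧ M' = N.fire M t

/-- Some run leads from the initial marking to `M`. -/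
def Reachable [Fintype P] (N : HITPN P T) (M : P → ℕ) : Prop :=
  Relation.ReflTransGen N.Step N.init M

/-- Coverability of the marking `M`: some marking `M' ≥ M` is reachable. -/
def Coverable [Fintype P] (N : HITPN P T) (M : P → ℕ) : Prop :=
  ∃ M' : P → ℕ, N.Reachable M' ∧ ∀ p : P, M p ≤ M' p

end HITPN

/-- The code of an arc, as a tag and an argument. -/
def Arc.code {n : ℕ} : Arc (Fin n) → ℕ × ℕ
  | Arc.weight k => (0, k)
  | Arc.inhibitor => (1, 0)
  | Arc.transfer q => (2, (q : ℕ))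

/-- The finite data given to an algorithm for coverability: the numbers of places and of
transitions, the table of the flow relation on `P × T`, the table of the flow relation on `T × P`,
the table of the hierarchy, the initial marking and the marking to be covered. -/
abbrev CoverCode : Type :=
  ℕ × ℕ × List (List (ℕ × ℕ)) × List (List ℕ) × List (List Bool) × List ℕ × List ℕ

open Classical in
/-- The instance of the coverability problem given by the net `N` and the marking `M`, written out
as finite data. -/
noncomputable def HITPN.coverCode {n m : ℕ} (N : HITPN (Fin n) (Fin m)) (M : Fin n → ℕ) :
    CoverCode :=
  (n, m,
    List.ofFn fun p => List.ofFn fun t => (N.pre p t).code,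
    List.ofFn fun t => List.ofFn fun p => N.post t p,
    List.ofFn fun p => List.ofFn fun q => decide (N.below p q),
    List.ofFn N.init,
    List.ofFn M)

theorem Arc.code_injective {n : ℕ} : Function.Injective (Arc.code (n := n)) := by
  intro a b h
  cases a <;> cases b <;> simp_all [Arc.code, Fin.ext_iff]

/-- The code determines the net and the marking: nothing is lost in the encoding. -/
theorem HITPN.coverCode_injective {n m : ℕ} {N N' : HITPN (Fin n) (Fin m)} {M M' : Fin n → ℕ}
    (h : N.coverCode M = N'.coverCode M') : N = N' ∧ M = M' := by
  obtain ⟨pre, post, below, h1, h2, init⟩ := N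
  obtain ⟨pre', post', below', h1', h2', init'⟩ := N'
  simp only [HITPN.coverCode, Prod.mk.injEq, List.ofFn_inj, true_and, funext_iff,
    decide_eq_decide] at h
  obtain ⟨a, b, c, d, e⟩ := h
  have a' : pre = pre' := funext fun p => funext fun t => Arc.code_injective (a p t)
  have b' : post = post' := funext fun t => funext fun p => b t p
  have c' : below = below' := funext fun p => funext fun q => propext (c p q)
  have d' : init = init' := funext d
  subst a' b' c' d'
  exact ⟨rfl, funext e⟩

/-! Counter automata and the relations on stores that they realize. -/

/-! These nets simulate counter automata with zero tests exactly. A transfer arc from a place back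
to itself returns every token, so it counts as special without changing anything. A zero test of one
counter therefore uses an inhibitor arc on that counter and self-transfers on all the others. With
the counters at the bottom of the hierarchy and the state places above them, the hierarchy condition
holds although every counter can be tested. Exactly one state place is marked at any time, so
covering it means reaching that state (`counterNet_coverable_iff`).

Counter automata compute all partial recursive functions, by induction on `Nat.Partrec'`
(`computes_of_partrec`). Automata are treated as relations on stores closed under composition and
iteration; an undefined value is the absence of a run to the exit state. For the universal function
this gives one fixed automaton whose input enters only through the initial marking. A decider for
coverability would then decide the halting problem. -/

namespace CounterMachine

open Relation Function

/-- The contents of the registers. -/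
abbrev Store : Type := ℕ → ℕ

/-- The instructions of a counter automaton. -/
inductive Instr : Type where
  | nop : Instr
  | inc (r : ℕ) : Instr
  | dec (r : ℕ) : Instr
  | zero (r : ℕ) : Instr

/-- The effect of an instruction; decrements and zero tests may block. -/
def Instr.Rel : Instr → Store → Store → Prop
  | .nop, s, s' => s' = s
  | .inc r, s, s' => s' = update s r (s r + 1)
  | .dec r, s, s' => 0 < s r ∧ s' = update s r (s r - 1)
  | .zero r, s, s' => s r = 0 ∧ s' = s

/-- The register that an instruction refers to. -/
def Instr.reg : Instr → ℕ
  | .nop => 0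
  | .inc r => r
  | .dec r => r
  | .zero r => r

/-- One step of the counter automaton with edges `E`. -/
def EdgeStep {Q : Type} (E : Set (Q × Instr × Q)) (x y : Q × Store) : Prop :=
  ∃ i, (x.1, i, y.1) ∈ E ∧ i.Rel x.2 y.2

/-- The relation on stores is the input-output relation of a finite counter automaton. -/
def Realizable (R : Store → Store → Prop) : Prop :=
  ∃ (Q : Type) (_ : Finite Q) (E : Set (Q × Instr × Q)) (_ : E.Finite) (a b : Q),
    ∀ s s', R s s' ↔ ReflTransGen (EdgeStep E) (a, s) (b, s')

/-- Relabelling of the states of an edge. -/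
def mapEdge {Q Q' : Type} (φ : Q → Q') (x : Q × Instr × Q) : Q' × Instr × Q' :=
  (φ x.1, x.2.1, φ x.2.2)

theorem reach_mapEdge {Q Q' : Type} {E : Set (Q × Instr × Q)} {E' : Set (Q' × Instr × Q')}
    (φ : Q → Q') (h : mapEdge φ '' E ⊆ E') {x y : Q × Store}
    (hxy : ReflTransGen (EdgeStep E) x y) :
    ReflTransGen (EdgeStep E') (φ x.1, x.2) (φ y.1, y.2) := by
  refine ReflTransGen.lift (fun x : Q × Store => (φ x.1, x.2)) ?_ _ _ hxy
  rintro ⟨p, s⟩ ⟨q, s'⟩ ⟨i, hi, hr⟩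
  exact ⟨i, h ⟨_, hi, rfl⟩, hr⟩

theorem realizable_instr (i : Instr) : Realizable i.Rel := by
  refine ⟨Bool, inferInstance, {(false, i, true)}, Set.finite_singleton _, false, true, ?_⟩
  intro s s'
  constructor
  · intro h
    exact ReflTransGen.single ⟨i, rfl, h⟩
  · intro h
    have key : ∀ y, ReflTransGen (EdgeStep {(false, i, true)}) (false, s) y →
        y = (false, s) ∨ (y.1 = true ∧ i.Rel s y.2) := by
      intro y hy
      induction hy with
      | refl => exact Or.inl rfl
      | @tail x y _ hxy ih =>
        obtain ⟨j, hj, hr⟩ := hxy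
        simp only [Set.mem_singleton_iff, Prod.mk.injEq] at hj
        obtain ⟨h1, rfl, h3⟩ := hj
        rcases ih with rfl | ⟨h4, _⟩
        · exact Or.inr ⟨h3, hr⟩
        · simp [h1] at h4
    rcases key _ h with h | h
    · simp at h
    · exact h.2

/-- The two automata are put side by side with a `nop` edge from the exit of the first to the entry
of the second. No edge leads back, so a run splits at its only crossing. -/
theorem Realizable.comp {R R' : Store → Store → Prop} (h : Realizable R) (h' : Realizable R') :
    Realizable (Comp R R') := by
  obtain ⟨Q, _, E, hE, a, b, hR⟩ := h
  obtain ⟨Q', _, E', hE', a', b', hR'⟩ := h'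
  refine ⟨Q ⊕ Q', inferInstance,
    mapEdge Sum.inl '' E ∪ mapEdge Sum.inr '' E' ∪ {(Sum.inl b, Instr.nop, Sum.inr a')},
    ((hE.image _).union (hE'.image _)).union (Set.finite_singleton _), Sum.inl a, Sum.inr b', ?_⟩
  set F := mapEdge Sum.inl '' E ∪ mapEdge Sum.inr '' E' ∪ {(Sum.inl b, Instr.nop, Sum.inr a')}
  intro s s'
  constructor
  · rintro ⟨m, h1, h2⟩
    have e1 := reach_mapEdge (E' := F) Sum.inl (fun x hx => Or.inl (Or.inl hx)) ((hR _ _).1 h1)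
    have e2 := reach_mapEdge (E' := F) Sum.inr (fun x hx => Or.inl (Or.inr hx)) ((hR' _ _).1 h2)
    exact (e1.tail (c := (Sum.inr a', m)) ⟨Instr.nop, Or.inr rfl, rfl⟩).trans e2
  · intro h
    have key : ∀ y, ReflTransGen (EdgeStep F) (Sum.inl a, s) y →
        (∃ q, y.1 = Sum.inl q ∧ ReflTransGen (EdgeStep E) (a, s) (q, y.2)) ∨
        (∃ q, y.1 = Sum.inr q ∧ ∃ m, R s m ∧ ReflTransGen (EdgeStep E') (a', m) (q, y.2)) := by
      intro y hy
      induction hy with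
      | refl => exact Or.inl ⟨a, rfl, .refl⟩
      | @tail x y _ hxy ih =>
        obtain ⟨i, hi, hr⟩ := hxy
        rcases hi with (⟨⟨p, j, q⟩, hE, he⟩ | ⟨⟨p, j, q⟩, hE, he⟩) | he
        · simp only [mapEdge, Prod.mk.injEq] at he
          obtain ⟨h1, rfl, h3⟩ := he
          rcases ih with ⟨p', hp, hs⟩ | ⟨p', hp, hs⟩
          · rw [← h1, Sum.inl.injEq] at hp
            subst hp
            exact Or.inl ⟨q, h3.symm, hs.tail ⟨j, hE, hr⟩⟩
          · simp [← h1] at hp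
        · simp only [mapEdge, Prod.mk.injEq] at he
          obtain ⟨h1, rfl, h3⟩ := he
          rcases ih with ⟨p', hp, hs⟩ | ⟨p', hp, m, hm, hs⟩
          · simp [← h1] at hp
          · rw [← h1, Sum.inr.injEq] at hp
            subst hp
            exact Or.inr ⟨q, h3.symm, m, hm, hs.tail ⟨j, hE, hr⟩⟩
        · simp only [Set.mem_singleton_iff, Prod.mk.injEq] at he
          obtain ⟨h1, rfl, h3⟩ := he
          rcases ih with ⟨p', hp, hs⟩ | ⟨p', hp, hs⟩
          · rw [h1, Sum.inl.injEq] at hp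
            subst hp
            refine Or.inr ⟨a', h3, x.2, (hR _ _).2 hs, ?_⟩
            rw [show y.2 = x.2 from hr]
          · simp [h1] at hp
    rcases key _ h with ⟨q, hq, _⟩ | ⟨q, hq, m, hm, hs⟩
    · simp at hq
    · rw [Sum.inr.injEq] at hq
      subst hq
      exact ⟨m, hm, (hR' _ _).2 hs⟩

/-- The fresh state `none` is both entry and exit. Visits to it separate the rounds, even if the
body passes through its own entry or exit in the middle of a round. -/
theorem Realizable.star {R : Store → Store → Prop} (h : Realizable R) :
    Realizable (ReflTransGen R) := by
  obtain ⟨Q, _, E, hE, a, b, hR⟩ := h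
  refine ⟨Option Q, inferInstance,
    mapEdge some '' E ∪ {(none, Instr.nop, some a), (some b, Instr.nop, none)},
    (hE.image _).union (Set.toFinite _), none, none, ?_⟩
  set F := mapEdge some '' E ∪ {(none, Instr.nop, some a), (some b, Instr.nop, none)}
  intro s s'
  constructor
  · intro h
    refine ReflTransGen.lift' (fun s : Store => ((none : Option Q), s)) ?_ _ _ h
    intro s s' hs
    have e := reach_mapEdge (E' := F) some (fun x hx => Or.inl hx) ((hR _ _).1 hs)
    exact (ReflTransGen.head ⟨Instr.nop, Or.inr (Or.inl rfl), rfl⟩ e).tail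
      ⟨Instr.nop, Or.inr (Or.inr rfl), rfl⟩
  · intro h
    have key : ∀ y, ReflTransGen (EdgeStep F) (none, s) y →
        (y.1 = none ∧ ReflTransGen R s y.2) ∨
        (∃ q, y.1 = some q ∧ ∃ m, ReflTransGen R s m ∧
          ReflTransGen (EdgeStep E) (a, m) (q, y.2)) := by
      intro y hy
      induction hy with
      | refl => exact Or.inl ⟨rfl, .refl⟩
      | @tail x y _ hxy ih =>
        obtain ⟨i, hi, hr⟩ := hxy
        rcases hi with ⟨⟨p, j, q⟩, hE, he⟩ | he | he
        · simp only [mapEdge, Prod.mk.injEq] at he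
          obtain ⟨h1, rfl, h3⟩ := he
          rcases ih with ⟨hp, _⟩ | ⟨p', hp, m, hm, hs⟩
          · simp [← h1] at hp
          · rw [← h1, Option.some.injEq] at hp
            subst hp
            exact Or.inr ⟨q, h3.symm, m, hm, hs.tail ⟨j, hE, hr⟩⟩
        · simp only [Prod.mk.injEq] at he
          obtain ⟨h1, rfl, h3⟩ := he
          rcases ih with ⟨_, hs⟩ | ⟨p', hp, _⟩
          · refine Or.inr ⟨a, h3, x.2, hs, ?_⟩
            rw [show y.2 = x.2 from hr]
          · simp [h1] at hp
        · simp only [Set.mem_singleton_iff, Prod.mk.injEq] at he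
          obtain ⟨h1, rfl, h3⟩ := he
          rcases ih with ⟨hp, _⟩ | ⟨p', hp, m, hm, hs⟩
          · simp [h1] at hp
          · rw [h1, Option.some.injEq] at hp
            subst hp
            refine Or.inl ⟨h3, ?_⟩
            rw [show y.2 = x.2 from hr]
            exact hm.tail ((hR _ _).2 hs)
    rcases key _ h with ⟨_, hs⟩ | ⟨q, hq, _⟩
    · exact hs
    · simp at hq

/-! ### Loops with a determined course -/

theorem comp_iff_of_eq {R R' : Store → Store → Prop} {s x : Store} (h : ∀ b, R s b ↔ b = x)
    (s' : Store) : Comp R R' s s' ↔ R' x s' := by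
  simp [Comp, h]

/-- The runs of a loop whose body follows the trajectory `σ`. -/
theorem star_iff_of_trajectory {R : Store → Store → Prop} (σ : ℕ → Store) (p : ℕ → Prop)
    (h : ∀ i s', R (σ i) s' ↔ p i ∧ s' = σ (i + 1)) (s' : Store) :
    ReflTransGen R (σ 0) s' ↔ ∃ i, (∀ j < i, p j) ∧ s' = σ i := by
  constructor
  · intro hs
    induction hs with
    | refl => exact ⟨0, by simp, rfl⟩
    | tail _ hbc ih =>
      obtain ⟨i, hi, rfl⟩ := ih
      obtain ⟨hp, rfl⟩ := (h _ _).1 hbc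
      refine ⟨i + 1, fun j hj => ?_, rfl⟩
      rcases Nat.lt_succ_iff_lt_or_eq.1 hj with hj | rfl
      · exact hi j hj
      · exact hp
  · rintro ⟨i, hi, rfl⟩
    induction i with
    | zero => exact .refl
    | succ i ih =>
      exact (ih fun j hj => hi j (by omega)).tail ((h _ _).2 ⟨hi i (by omega), rfl⟩)

/-- Repeat `R` until the register `a` is zero. -/
def untilZero (a : ℕ) (R : Store → Store → Prop) : Store → Store → Prop :=
  Comp (ReflTransGen R) (Instr.zero a).Rel

theorem Realizable.untilZero {R : Store → Store → Prop} (h : Realizable R) (a : ℕ) :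
    Realizable (untilZero a R) :=
  h.star.comp (realizable_instr _)

/-- Iteration may stop after any number of rounds, but the body blocks after `k` rounds and the zero
test blocks before, so only the exit after exactly `k` rounds survives. -/
theorem untilZero_iff {R : Store → Store → Prop} {a : ℕ} (σ : ℕ → Store) (k : ℕ)
    (ha : ∀ i, σ i a = k - i) (h : ∀ i s', R (σ i) s' ↔ i < k ∧ s' = σ (i + 1)) (s' : Store) :
    untilZero a R (σ 0) s' ↔ s' = σ k := by
  simp only [untilZero, Comp, star_iff_of_trajectory σ _ h, Instr.Rel]
  constructor
  · rintro ⟨_, ⟨i, hi, rfl⟩, h0, rfl⟩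
    rw [ha] at h0
    -- The truncated subtraction in `ha` gives only `k ≤ i`; the other bound holds because round `k`
    -- cannot be carried out.
    have : i ≤ k := by
      by_contra hc
      exact absurd (hi k (by omega)) (lt_irrefl k)
    rw [show i = k by omega]
  · rintro rfl
    exact ⟨_, ⟨k, fun j hj => hj, rfl⟩, by simp [ha], rfl⟩

/-! ### Moving, copying and clearing registers -/

theorem exists_realizable_move {a b : ℕ} (hab : a ≠ b) :
    ∃ R, Realizable R ∧ ∀ s s', R s s' ↔ s' = update (update s b (s b + s a)) a 0 := by
  refine ⟨_, ((realizable_instr (.dec a)).comp (realizable_instr (.inc b))).untilZero a, ?_⟩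
  intro s s'
  have := untilZero_iff (R := Comp (Instr.dec a).Rel (Instr.inc b).Rel) (a := a)
    (fun i => update (update s b (s b + i)) a (s a - i)) (s a) (by simp) ?_ s'
  · simpa using this
  · intro i s'
    simp only [Comp, Instr.Rel, and_assoc, exists_and_left, exists_eq_left, update_self]
    refine and_congr (by omega) (Eq.congr_right ?_)
    ext r
    simp only [update_apply]
    grind

/-- Reading `a` destroys it, so it is emptied into `b` and `t` together and then restored from `t`.
-/
theorem exists_realizable_copy {a b t : ℕ} (hab : a ≠ b) (hat : a ≠ t) (hbt : b ≠ t) :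
    ∃ R, Realizable R ∧ ∀ s, s t = 0 → ∀ s', R s s' ↔ s' = update s b (s b + s a) := by
  obtain ⟨R, hR, hR'⟩ := exists_realizable_move hat.symm
  refine ⟨_, (((realizable_instr (.dec a)).comp ((realizable_instr (.inc b)).comp
    (realizable_instr (.inc t)))).untilZero a).comp hR, ?_⟩
  intro s hs s'
  have := untilZero_iff
    (R := Comp (Instr.dec a).Rel (Comp (Instr.inc b).Rel (Instr.inc t).Rel)) (a := a)
    (fun i => update (update (update s b (s b + i)) t i) a (s a - i)) (s a) (by simp) ?_
  · have h0 : update (update (update s b (s b + 0)) t 0) a (s a - 0) = s := by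
      ext r
      simp only [update_apply]
      grind
    simp only [h0] at this
    rw [comp_iff_of_eq this, hR']
    refine Eq.congr_right ?_
    ext r
    simp only [update_apply]
    grind
  · intro i s'
    simp only [Comp, Instr.Rel, and_assoc, exists_and_left, exists_eq_left, update_self]
    refine and_congr (by omega) (Eq.congr_right ?_)
    ext r
    simp only [update_apply]
    grind

theorem exists_realizable_clear (c n : ℕ) :
    ∃ R, Realizable R ∧ ∀ s s', R s s' ↔ s' = fun r => if c ≤ r ∧ r < c + n then 0 else s r := by
  induction n with
  | zero =>
    refine ⟨_, realizable_instr .nop, fun s s' => ?_⟩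
    simp only [Instr.Rel]
    refine Eq.congr_right ?_
    ext r
    grind
  | succ n ih =>
    obtain ⟨R, hR, hR'⟩ := ih
    refine ⟨_, ((realizable_instr (.dec (c + n))).untilZero (c + n)).comp hR, fun s s' => ?_⟩
    have := untilZero_iff (R := (Instr.dec (c + n)).Rel) (a := c + n)
      (fun i => update s (c + n) (s (c + n) - i)) (s (c + n)) (by simp) ?_
    · simp only [Nat.sub_zero, update_eq_self] at this
      rw [comp_iff_of_eq this, hR']
      refine Eq.congr_right ?_
      ext r
      simp only [update_apply]
      grind
    · intro i s'
      simp only [Instr.Rel, update_self]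
      refine and_congr (by omega) (Eq.congr_right ?_)
      ext r
      simp only [update_apply]
      grind

/-! ### Counter automata compute the partial recursive functions -/

/-- The store that agrees with `s` below `c` and holds the list `l`, followed by zeros, from
register `c` on. -/
def extend (s : Store) (c : ℕ) (l : List ℕ) : Store :=
  fun r => if r < c then s r else l.getD (r - c) 0

/-- All registers from `c` on are zero. -/
def Clean (c : ℕ) (s : Store) : Prop := ∀ r, c ≤ r → s r = 0

theorem clean_extend {s : Store} {c c' : ℕ} {l : List ℕ} (h : c + l.length ≤ c') :
    Clean c' (extend s c l) := by
  intro r hr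
  rw [extend, if_neg (by omega), List.getD_eq_default _ _ (by omega)]

theorem extend_lt {s : Store} {c r : ℕ} {l : List ℕ} (h : r < c) : extend s c l r = s r :=
  if_pos h

theorem extend_add {s : Store} {c i : ℕ} {l : List ℕ} : extend s c l (c + i) = l.getD i 0 := by
  simp [extend]

theorem extend_self {s : Store} {c : ℕ} {l : List ℕ} : extend s c l c = l.getD 0 0 := by
  simp [extend]

/-- Some counter automaton adds the value of `f` at the contents of the registers `inp` to the
register `out`, using the registers from `base` on as scratch space and restoring them to zero. -/
def Computes {n : ℕ} (f : List.Vector ℕ n →. ℕ) : Prop :=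
  ∀ (inp : Fin n → ℕ) (out base : ℕ), (∀ i, inp i < base) → (∀ i, inp i ≠ out) → out < base →
    ∃ R, Realizable R ∧ ∀ s, Clean base s → ∀ s', R s s' ↔
      ∃ y ∈ f (List.Vector.ofFn fun i => s (inp i)), s' = update s out (s out + y)

theorem computes_zero : Computes (n := 0) fun _ => Part.some 0 := by
  intro inp out base _ _ _
  refine ⟨_, realizable_instr .nop, fun s _ s' => ?_⟩
  simp [Instr.Rel]

theorem computes_get {n : ℕ} (i : Fin n) : Computes fun v => Part.some (v.get i) := by
  intro inp out base h1 h2 h3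
  have := h1 i
  obtain ⟨R, hR, hR'⟩ := exists_realizable_copy (h2 i) (t := base) (by omega) (by omega)
  refine ⟨R, hR, fun s hs s' => ?_⟩
  rw [hR' s (hs _ le_rfl)]
  simp

theorem computes_succ : Computes (n := 1) fun v => Part.some v.head.succ := by
  intro inp out base h1 h2 h3
  have := h1 0
  obtain ⟨R, hR, hR'⟩ := exists_realizable_copy (h2 0) (t := base) (by omega) (by omega)
  refine ⟨_, hR.comp (realizable_instr (.inc out)), fun s hs s' => ?_⟩
  rw [comp_iff_of_eq (hR' s (hs _ le_rfl))]
  simp [Instr.Rel, add_assoc]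

/-- Each value goes into the first free register `c`, and the remaining functions start from `c +
1`; the inputs lie below `c` and stay intact. -/
theorem exists_realizable_mOfFn {m : ℕ} (inp : Fin m → ℕ) {n : ℕ}
    (g : Fin n → List.Vector ℕ m →. ℕ) (hg : ∀ i, Computes (g i)) (c : ℕ)
    (hc : ∀ i, inp i < c) :
    ∃ R, Realizable R ∧ ∀ s, Clean c s → ∀ s', R s s' ↔
      ∃ w ∈ List.Vector.mOfFn (fun i => g i (List.Vector.ofFn fun j => s (inp j))),
        s' = extend s c w.toList := by
  induction n generalizing c with
  | zero =>
    refine ⟨_, realizable_instr .nop, fun s hs s' => ?_⟩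
    have : extend s c [] = s := by
      ext r
      have := hs r
      simp only [extend, List.getD_nil]
      grind
    simp [Instr.Rel, List.Vector.mOfFn, this]
  | succ n ih =>
    obtain ⟨R, hR, hR'⟩ := hg 0 inp c (c + 1) (fun i => (hc i).trans (by omega))
      (fun i => (hc i).ne) (by omega)
    obtain ⟨T, hT, hT'⟩ := ih (fun i => g i.succ) (fun i => hg _) (c + 1)
      (fun i => (hc i).trans (by omega))
    refine ⟨_, hR.comp hT, fun s hs s' => ?_⟩
    have e1 : ∀ y j, update s c (s c + y) (inp j) = s (inp j) := fun y j =>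
      update_of_ne (hc j).ne _ _
    have e2 : ∀ y, Clean (c + 1) (update s c (s c + y)) := fun y r hr => by
      rw [update_of_ne (by omega)]
      exact hs r (by omega)
    have e3 : ∀ y l, extend (update s c (s c + y)) (c + 1) l = extend s c (y :: l) := by
      intro y l
      ext r
      have := hs c le_rfl
      simp only [extend, update_apply]
      rcases lt_trichotomy r c with h | rfl | h
      · grind
      · simp [this]
      · obtain ⟨d, rfl⟩ := Nat.exists_eq_add_of_lt h
        simp [show c + d + 1 - (c + 1) = d by omega, show c + d + 1 - c = d + 1 by omega,
          show ¬ c + d < c by omega, show ¬ c + d + 1 < c by omega]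
    have e0 : Clean (c + 1) s := fun r hr => hs r (by omega)
    simp only [Comp, hR' s e0, List.Vector.mOfFn]
    constructor
    · rintro ⟨_, ⟨y, hy, rfl⟩, h⟩
      obtain ⟨w, hw, rfl⟩ := (hT' _ (e2 y) _).1 h
      simp only [e1] at hw
      refine ⟨y ::ᵥ w, ?_, by simp [e3]⟩
      simp only [Part.bind_eq_bind, Part.mem_bind_iff]
      exact ⟨y, hy, w, hw, by simp⟩
    · rintro ⟨w', hw', rfl⟩
      simp only [Part.bind_eq_bind, Part.mem_bind_iff] at hw'
      obtain ⟨y, hy, w, hw, hw'⟩ := hw'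
      simp at hw'
      subst hw'
      refine ⟨_, ⟨y, hy, rfl⟩, (hT' _ (e2 y) _).2 ⟨w, ?_, by simp [e3]⟩⟩
      simpa only [e1] using hw

/-- The intermediate values occupy `base, …, base + n - 1`, serve as the inputs of `f`, and are
cleared at the end. -/
theorem Computes.comp {m n : ℕ} {f : List.Vector ℕ n →. ℕ} {g : Fin n → List.Vector ℕ m →. ℕ}
    (hf : Computes f) (hg : ∀ i, Computes (g i)) :
    Computes fun v => (List.Vector.mOfFn fun i => g i v) >>= f := by
  intro inp out base h1 h2 h3
  obtain ⟨R, hR, hR'⟩ := exists_realizable_mOfFn inp g hg base h1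
  obtain ⟨T, hT, hT'⟩ := hf (fun i => base + i) out (base + n) (by simp) (by omega) (by omega)
  obtain ⟨U, hU, hU'⟩ := exists_realizable_clear base n
  refine ⟨_, hR.comp (hT.comp hU), fun s hs s' => ?_⟩
  have e1 : ∀ w : List.Vector ℕ n,
      (List.Vector.ofFn fun i : Fin n => extend s base w.toList (base + i)) = w := by
    intro w
    ext i
    simp [extend_add, List.Vector.get_eq_get_toList]
  have e2 : ∀ w : List.Vector ℕ n, Clean (base + n) (extend s base w.toList) :=
    fun w => clean_extend (by simp)
  have e3 : ∀ (w : List.Vector ℕ n) y, (fun r => if base ≤ r ∧ r < base + n then 0 else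
      update (extend s base w.toList) out (extend s base w.toList out + y) r) =
      update s out (s out + y) := by
    intro w y
    ext r
    rw [extend_lt h3]
    have := hs r
    have := e2 w r
    have : r < base → extend s base w.toList r = s r := extend_lt
    simp only [update_apply]
    grind
  simp only [Comp, hR' s hs, hU']
  constructor
  · rintro ⟨_, ⟨w, hw, rfl⟩, _, h, rfl⟩
    obtain ⟨y, hy, rfl⟩ := (hT' _ (e2 w) _).1 h
    rw [e1] at hy
    exact ⟨y, Part.mem_bind hw hy, e3 w y⟩
  · rintro ⟨y, hy, rfl⟩
    obtain ⟨w, hw, hy⟩ := Part.mem_bind_iff.1 hy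
    refine ⟨_, ⟨w, hw, rfl⟩, _, (hT' _ (e2 w) _).2 ⟨y, ?_, rfl⟩, (e3 w y).symm⟩
    rwa [e1]

/-- Register `base` holds the candidate and `base + 1` the value of `f` there. If no candidate is a
zero of `f`, the final zero test never succeeds and no run reaches the exit. -/
theorem Computes.rfind {n : ℕ} {f : List.Vector ℕ (n + 1) → ℕ}
    (hf : Computes fun v => Part.some (f v)) :
    Computes fun v => Nat.rfind fun i => Part.some (decide (f (i ::ᵥ v) = 0)) := by
  intro inp out base h1 h2 h3
  obtain ⟨R, hR, hR'⟩ := hf (Fin.cons base inp) (base + 1) (base + 2)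
    (fun i => by
      refine Fin.cases (by simp) (fun i => ?_) i
      have := h1 i
      simp only [Fin.cons_succ]
      omega)
    (fun i => by
      refine Fin.cases (by simp) (fun i => ?_) i
      have := h1 i
      simp only [Fin.cons_succ]
      omega) (by omega)
  obtain ⟨U, hU, hU'⟩ := exists_realizable_clear (base + 1) 1
  obtain ⟨V, hV, hV'⟩ := exists_realizable_move (a := base) (b := out) (by omega)
  -- The decrement inside the loop acts as a test that the value is nonzero. On exit the value is
  -- computed once more and tested for zero.
  refine ⟨_, (hR.comp ((realizable_instr (.dec (base + 1))).comp
    (hU.comp (realizable_instr (.inc base))))).star.comp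
    (hR.comp ((realizable_instr (.zero (base + 1))).comp hV)), fun s hs s' => ?_⟩
  set v : List.Vector ℕ n := List.Vector.ofFn fun i => s (inp i) with hv
  have e1 : ∀ i s', R (extend s base [i]) s' ↔ s' = extend s base [i, f (i ::ᵥ v)] := by
    intro i s'
    rw [hR' _ (clean_extend (by simp))]
    have : (List.Vector.ofFn fun j => extend s base [i]
        ((Fin.cons base inp : Fin (n + 1) → ℕ) j)) = i ::ᵥ v := by
      simp [List.Vector.ofFn, extend_self, extend_lt (h1 _), hv]
    simp only [this, Part.mem_some_iff, exists_eq_left]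
    refine Eq.congr_right ?_
    ext r
    simp only [extend, update_apply]
    rcases lt_trichotomy r (base + 1) with h | rfl | h
    · grind
    · simp
    · grind
  have e2 := star_iff_of_trajectory (R := Comp R (Comp (Instr.dec (base + 1)).Rel
      (Comp U (Instr.inc base).Rel))) (fun i => extend s base [i]) (fun i => f (i ::ᵥ v) ≠ 0) (by
    intro i s'
    rw [comp_iff_of_eq (e1 i)]
    simp only [Comp, Instr.Rel, and_assoc, exists_and_left, exists_eq_left, hU', extend_add]
    refine and_congr (by simp [Nat.pos_iff_ne_zero]) (Eq.congr_right ?_)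
    ext r
    simp only [extend, update_apply]
    grind)
  have e3 : extend s base [0] = s := by
    ext r
    have := hs r
    simp only [extend]
    grind
  simp only [e3] at e2
  have e4 : ∀ i, update (update (extend s base [i, 0]) out (extend s base [i, 0] out +
      extend s base [i, 0] base)) base 0 = update s out (s out + i) := by
    intro i
    ext r
    have := hs r
    simp only [extend, update_apply]
    grind
  rw [Comp]
  simp only [e2]
  constructor
  · rintro ⟨_, ⟨i, hi, rfl⟩, h⟩
    rw [comp_iff_of_eq (e1 i)] at h
    obtain ⟨_, ⟨h0, rfl⟩, h⟩ := h
    rw [extend_add] at h0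
    have h0 : f (i ::ᵥ v) = 0 := by simpa using h0
    rw [hV', h0, e4] at h
    exact ⟨i, Nat.mem_rfind.2 ⟨by simp [h0], fun {j} hj => by simpa using hi j hj⟩, h⟩
  · rintro ⟨i, hi, rfl⟩
    obtain ⟨h0, hi⟩ := Nat.mem_rfind.1 hi
    have h0 : f (i ::ᵥ v) = 0 := by simpa using h0
    refine ⟨_, ⟨i, fun j hj => by simpa using hi hj, rfl⟩, ?_⟩
    rw [comp_iff_of_eq (e1 i)]
    refine ⟨_, ⟨by simp [extend_add, h0], rfl⟩, ?_⟩
    rw [hV', h0, e4]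

/-- From `base` on, four registers hold the number of rounds left, the recursion index, the current
value and the next value; scratch space begins at `base + 4`. -/
theorem Computes.prec {n : ℕ} {f : List.Vector ℕ n → ℕ} {g : List.Vector ℕ (n + 2) → ℕ}
    (hf : Computes fun v => Part.some (f v)) (hg : Computes fun v => Part.some (g v)) :
    Computes fun v : List.Vector ℕ (n + 1) => Part.some
      (v.head.rec (f v.tail) fun y IH => g (y ::ᵥ IH ::ᵥ v.tail) : ℕ) := by
  intro inp out base h1 h2 h3
  have h10 := h1 0
  have h1s := fun i : Fin n => h1 i.succ
  obtain ⟨A, hA, hA'⟩ := exists_realizable_copy (a := inp 0) (b := base) (t := base + 4)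
    (by omega) (by omega) (by omega)
  obtain ⟨B, hB, hB'⟩ := hf (fun i => inp i.succ) (base + 2) (base + 4)
    (fun i => by have := h1s i; omega) (fun i => by have := h1s i; omega) (by omega)
  obtain ⟨C, hC, hC'⟩ := hg (Fin.cons (base + 1) (Fin.cons (base + 2) fun i => inp i.succ))
    (base + 3) (base + 4)
    (fun i => by
      refine Fin.cases (by simp) (fun i => ?_) i
      refine Fin.cases (by simp) (fun i => ?_) i
      have := h1s i
      simp only [Fin.cons_succ]
      omega)
    (fun i => by
      refine Fin.cases (by simp) (fun i => ?_) i
      refine Fin.cases (by simp) (fun i => ?_) i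
      have := h1s i
      simp only [Fin.cons_succ]
      omega) (by omega)
  obtain ⟨D, hD, hD'⟩ := exists_realizable_clear (base + 2) 1
  obtain ⟨F, hF, hF'⟩ := exists_realizable_move (a := base + 3) (b := base + 2) (by omega)
  obtain ⟨G, hG, hG'⟩ := exists_realizable_move (a := base + 2) (b := out) (by omega)
  obtain ⟨H, hH, hH'⟩ := exists_realizable_clear base 4
  refine ⟨_, hA.comp (hB.comp ((((realizable_instr (.dec base)).comp (hC.comp (hD.comp (hF.comp
    (realizable_instr (.inc (base + 1))))))).untilZero base).comp (hG.comp hH))),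
    fun s hs s' => ?_⟩
  set v : List.Vector ℕ n := List.Vector.ofFn fun i => s (inp i.succ) with hv
  set k := s (inp 0) with hk
  set a : ℕ → ℕ := fun i => i.rec (f v) fun y IH => g (y ::ᵥ IH ::ᵥ v)
  have ha0 : a 0 = f v := rfl
  have ha1 : ∀ i, a (i + 1) = g (i ::ᵥ a i ::ᵥ v) := fun i => rfl
  have ha2 : ∀ i, (i.rec (f v) fun y IH => g (y ::ᵥ IH ::ᵥ v) : ℕ) = a i := fun i => rfl
  clear_value a
  have e1 := hA' s (hs _ (by omega))
  have e1' : update s base (s base + s (inp 0)) = extend s base [k] := by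
    ext r
    have := hs r
    simp only [extend, update_apply]
    grind
  rw [e1'] at e1
  -- The form `k - 0` matches the loop trajectory of `e4` at round 0.
  have e2 : ∀ s', B (extend s base [k]) s' ↔ s' = extend s base [k - 0, 0, a 0, 0] := by
    intro s'
    rw [hB' _ (clean_extend (by simp))]
    simp only [extend_lt (h1s _), ← hv, Part.mem_some_iff, exists_eq_left]
    refine Eq.congr_right ?_
    ext r
    simp only [extend, update_apply, ← ha0]
    grind
  have e3 : ∀ i d s', C (extend s base [d, i, a i, 0]) s' ↔
      s' = extend s base [d, i, a i, a (i + 1)] := by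
    intro i d s'
    rw [hC' _ (clean_extend (by simp))]
    have : (List.Vector.ofFn fun j => extend s base [d, i, a i, 0]
        ((Fin.cons (base + 1) (Fin.cons (base + 2) fun i => inp i.succ) : Fin (n + 2) → ℕ) j)) =
        i ::ᵥ a i ::ᵥ v := by
      simp [List.Vector.ofFn, extend_add, extend_lt (h1s _), hv]
    simp only [this, Part.mem_some_iff, exists_eq_left, ← ha1]
    refine Eq.congr_right ?_
    ext r
    simp only [extend, update_apply]
    grind
  have e4 := untilZero_iff (R := Comp (Instr.dec base).Rel (Comp C (Comp D (Comp F
      (Instr.inc (base + 1)).Rel)))) (a := base) (fun i => extend s base [k - i, i, a i, 0]) k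
    (by simp [extend_self]) (by
      intro i s'
      have e5 : update (extend s base [k - i, i, a i, 0]) base (k - i - 1) =
          extend s base [k - (i + 1), i, a i, 0] := by
        ext r
        simp only [extend, update_apply]
        grind
      simp only [Comp, Instr.Rel, and_assoc, exists_and_left, exists_eq_left, hD', hF',
        extend_self, List.getD_cons_zero, e5, e3]
      refine and_congr (by omega) (Eq.congr_right ?_)
      ext r
      simp only [extend, update_apply]
      grind)
  rw [comp_iff_of_eq e1, comp_iff_of_eq e2, comp_iff_of_eq e4, comp_iff_of_eq (hG' _), hH']
  have e6 : (List.Vector.ofFn fun i => s (inp i)) = k ::ᵥ v := by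
    simp [List.Vector.ofFn, hv, hk]
  simp only [e6, List.Vector.head_cons, List.Vector.tail_cons, ha2, Part.mem_some_iff, exists_eq_left]
  refine Eq.congr_right ?_
  ext r
  have := hs r
  simp only [extend, update_apply]
  grind

theorem computes_of_primrec {n : ℕ} {f : List.Vector ℕ n → ℕ} (hf : Nat.Primrec' f) :
    Computes fun v => Part.some (f v) := by
  induction hf with
  | zero => exact computes_zero
  | succ => exact computes_succ
  | get i => exact computes_get i
  | comp g _ _ ihf ihg =>
    have := ihf.comp ihg
    simpa only [← Part.pure_eq_some, List.Vector.mOfFn_pure, pure_bind] using this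
  | prec _ _ ihf ihg => exact ihf.prec ihg

theorem computes_of_partrec {n : ℕ} {f : List.Vector ℕ n →. ℕ} (hf : Nat.Partrec' f) :
    Computes f := by
  induction hf with
  | prim hf => exact computes_of_primrec hf
  | comp g _ _ ihf ihg => exact ihf.comp ihg
  | rfind _ ih => exact ih.rfind

/-! ### Nets that simulate counter automata -/

/-- The arcs into a transition that performs the instruction `i` on the counters, seen from the
counter `r`. Zero tests put self-transfers on the other counters, so that they respect every
hierarchy on the counters. -/
def Instr.preArc {P : Type} : Instr → ℕ → P → Arc P
  | .nop, _, _ => .weight 0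
  | .inc _, _, _ => .weight 0
  | .dec r', r, _ => .weight (if r = r' then 1 else 0)
  | .zero r', r, p => if r = r' then .inhibitor else .transfer p

/-- The weight of the arc from a transition that performs the instruction `i` to the counter `r`. -/
def Instr.postWeight : Instr → ℕ → ℕ
  | .inc r', r => if r = r' then 1 else 0
  | _, _ => 0

/-- The marking of the places of a counter net: the places `0, …, B` are the counters and the
place `B + 1 + q` is marked if `q` is the current state. -/
def marking (B : ℕ) {k : ℕ} (q : Fin k) (s : Store) (p : Fin (B + k + 1)) : ℕ :=
  if (p : ℕ) ≤ B then s p else if (p : ℕ) = B + 1 + q then 1 else 0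

/-- The net that simulates the counter automaton with the given edges on the registers
`0, …, B`. -/
def counterNet (B : ℕ) {k m : ℕ} (edge : Fin m → Fin k × Instr × Fin k) (q : Fin k) (s : Store) :
    HITPN (Fin (B + k + 1)) (Fin m) where
  pre p t := if (p : ℕ) ≤ B then (edge t).2.1.preArc p p
    else .weight (if (p : ℕ) = B + 1 + (edge t).1 then 1 else 0)
  post t p := if (p : ℕ) ≤ B then (edge t).2.1.postWeight p
    else if (p : ℕ) = B + 1 + (edge t).2.2 then 1 else 0
  below p q := p ≤ q
  below_linear := inferInstanceAs (IsLinearOrder (Fin (B + k + 1)) (· ≤ ·))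
  -- Special arcs occur only at counters, for zero tests, and then every counter has one; the places
  -- below a counter are again counters.
  hierarchical := by
    intro p t h q hq
    have hp : (p : ℕ) ≤ B := by
      by_contra hp
      rw [if_neg hp] at h
      exact h _ rfl
    have hq : (q : ℕ) ≤ B := le_trans hq hp
    rw [if_pos hp] at h
    rw [if_pos hq]
    generalize (edge t).2.1 = i at h
    cases i with
    | zero r =>
      intro k
      simp only [Instr.preArc]
      split <;> simp
    | _ => exact absurd rfl (h _)
  init := marking B q s

section Simulation

variable {B k m : ℕ} (edge : Fin m → Fin k × Instr × Fin k) (q₀ : Fin k) (s₀ : Store)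

theorem eq_of_counterNet_pre_eq_transfer {t : Fin m} {p q : Fin (B + k + 1)}
    (h : (counterNet B edge q₀ s₀).pre p t = .transfer q) : p = q := by
  simp only [counterNet] at h
  split_ifs at h
  generalize (edge t).2.1 = i at h
  cases i <;> simp only [Instr.preArc, reduceCtorEq] at h
  split_ifs at h
  exact Arc.transfer.inj h

/-- All transfers are self-transfers, so only the summand of `p` itself can contribute: a
transferred place gets back exactly what it loses. -/
theorem counterNet_transferred (M : Fin (B + k + 1) → ℕ) (t : Fin m) (p : Fin (B + k + 1)) :
    (counterNet B edge q₀ s₀).transferred M t p =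
      match (counterNet B edge q₀ s₀).pre p t with
      | .transfer _ => M p
      | _ => 0 := by
  rw [HITPN.transferred, Finset.sum_eq_single p]
  · cases h : (counterNet B edge q₀ s₀).pre p t with
    | transfer q =>
      obtain rfl := eq_of_counterNet_pre_eq_transfer edge q₀ s₀ h
      simp
    | _ => simp
  · exact fun q _ hq => if_neg fun h => hq (eq_of_counterNet_pre_eq_transfer edge q₀ s₀ h)
  · simp

theorem marking_counter {q : Fin k} {s : Store} {r : ℕ} (hr : r ≤ B) :
    marking B q s ⟨r, by omega⟩ = s r := if_pos hr

theorem marking_state {q q' : Fin k} {s : Store} :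
    marking B q s ⟨B + 1 + q', by omega⟩ = if q' = q then 1 else 0 := by
  simp [marking, Fin.ext_iff, add_assoc]

theorem counterNet_firable_iff (hedge : ∀ t, (edge t).2.1.reg ≤ B) (q : Fin k) (s : Store)
    (t : Fin m) :
    (counterNet B edge q₀ s₀).Firable (marking B q s) t ↔
      (edge t).1 = q ∧ ∃ s', (edge t).2.1.Rel s s' := by
  have hB := hedge t
  obtain ⟨⟨a, i, b⟩, he⟩ : ∃ e, edge t = e := ⟨_, rfl⟩
  simp only [he] at hB ⊢
  constructor
  · intro h
    constructor
    · have h1 := h ⟨B + 1 + a, by omega⟩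
      simp only [counterNet, he, if_neg (show ¬ B + 1 + (a : ℕ) ≤ B by omega), if_true,
        marking_state] at h1
      by_contra hc
      simp [hc] at h1
    -- Whether the instruction is enabled depends only on its own register, so the firing condition
    -- at that single counter suffices.
    · have h1 := h ⟨i.reg, by omega⟩
      simp only [counterNet, he, if_pos hB, marking_counter hB] at h1
      cases i <;> (simp_all [Instr.Rel, Instr.preArc, Instr.reg]; try omega)
  · rintro ⟨rfl, s', hs⟩ p
    by_cases hp : (p : ℕ) ≤ B
    · simp only [counterNet, he, if_pos hp, marking]
      cases i with
      | nop => simp [Instr.preArc]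
      | inc r => simp [Instr.preArc]
      | dec r =>
        simp only [Instr.preArc]
        split_ifs with h
        · rw [h]
          exact hs.1
        · exact Nat.zero_le _
      | zero r =>
        by_cases h : (p : ℕ) = r
        · simp only [Instr.preArc, if_pos h]
          rw [h]
          exact hs.1
        · simp [Instr.preArc, if_neg h]
    · simp [counterNet, he, if_neg hp, marking]

theorem counterNet_fire (s s' : Store) (t : Fin m) (h : (edge t).2.1.Rel s s') :
    (counterNet B edge q₀ s₀).fire (marking B (edge t).1 s) t = marking B (edge t).2.2 s' := by
  ext p
  simp only [HITPN.fire, counterNet_transferred, HITPN.kept]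
  obtain ⟨⟨a, i, b⟩, he⟩ : ∃ e, edge t = e := ⟨_, rfl⟩
  simp only [he] at h ⊢
  by_cases hp : (p : ℕ) ≤ B
  · simp only [counterNet, he, if_pos hp, marking]
    cases i with
    | nop =>
      obtain rfl := h
      simp [Instr.preArc, Instr.postWeight]
    | inc r =>
      obtain rfl := h
      simp only [Instr.preArc, Instr.postWeight, update_apply]
      split_ifs <;> simp_all
    | dec r =>
      obtain ⟨_, rfl⟩ := h
      simp only [Instr.preArc, Instr.postWeight, update_apply]
      split_ifs <;> simp_all
    | zero r =>
      obtain ⟨h0, rfl⟩ := h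
      by_cases h : (p : ℕ) = r <;> simp [Instr.preArc, Instr.postWeight, h]
  · simp [counterNet, he, if_neg hp, marking]

theorem counterNet_step_iff (hedge : ∀ t, (edge t).2.1.reg ≤ B) (q : Fin k) (s : Store)
    (M : Fin (B + k + 1) → ℕ) :
    (counterNet B edge q₀ s₀).Step (marking B q s) M ↔
      ∃ y : Fin k × Store, EdgeStep (Set.range edge) (q, s) y ∧ M = marking B y.1 y.2 := by
  constructor
  · rintro ⟨t, ht, rfl⟩
    obtain ⟨rfl, s', hs⟩ := (counterNet_firable_iff edge q₀ s₀ hedge q s t).1 ht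
    exact ⟨((edge t).2.2, s'), ⟨_, ⟨t, rfl⟩, hs⟩, counterNet_fire edge q₀ s₀ s s' t hs⟩
  · rintro ⟨⟨q', s'⟩, ⟨i, ⟨t, ht⟩, hs⟩, rfl⟩
    obtain ⟨rfl, rfl, rfl⟩ : (edge t).1 = q ∧ (edge t).2.1 = i ∧ (edge t).2.2 = q' := by simp [ht]
    exact ⟨t, (counterNet_firable_iff edge q₀ s₀ hedge _ s t).2 ⟨rfl, s', hs⟩,
      (counterNet_fire edge q₀ s₀ s s' t hs).symm⟩

theorem counterNet_reachable_iff (hedge : ∀ t, (edge t).2.1.reg ≤ B) (M : Fin (B + k + 1) → ℕ) :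
    (counterNet B edge q₀ s₀).Reachable M ↔ ∃ y : Fin k × Store,
      ReflTransGen (EdgeStep (Set.range edge)) (q₀, s₀) y ∧ M = marking B y.1 y.2 := by
  constructor
  · intro h
    induction h with
    | refl => exact ⟨_, .refl, rfl⟩
    | tail _ hst ih =>
      obtain ⟨y, hy, rfl⟩ := ih
      obtain ⟨z, hz, rfl⟩ := (counterNet_step_iff edge q₀ s₀ hedge _ _ _).1 hst
      exact ⟨z, hy.tail hz, rfl⟩
  · rintro ⟨y, hy, rfl⟩
    induction hy with
    | refl => exact .refl
    | tail _ hst ih =>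
      exact ih.tail ((counterNet_step_iff edge q₀ s₀ hedge _ _ _).2 ⟨_, hst, rfl⟩)

/-- The target asks for one token on the place of `q` and nothing else. Reachable markings encode
configurations, and these mark only the current state. -/
theorem counterNet_coverable_iff (hedge : ∀ t, (edge t).2.1.reg ≤ B) (q : Fin k) :
    (counterNet B edge q₀ s₀).Coverable (marking B q fun _ => 0) ↔
      ∃ s, ReflTransGen (EdgeStep (Set.range edge)) (q₀, s₀) (q, s) := by
  simp only [HITPN.Coverable, counterNet_reachable_iff edge q₀ s₀ hedge]
  constructor
  · rintro ⟨_, ⟨⟨q', s⟩, h, rfl⟩, hc⟩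
    have := hc ⟨B + 1 + q, by omega⟩
    simp only [marking_state, if_true] at this
    by_cases hq : q = q'
    · subst hq
      exact ⟨s, h⟩
    · simp [hq] at this
  · rintro ⟨s, h⟩
    refine ⟨_, ⟨_, h, rfl⟩, fun p => ?_⟩
    simp only [marking]
    split_ifs <;> simp

end Simulation

/-! ### Reduction from the halting problem -/

theorem Realizable.exists_edge {R : Store → Store → Prop} (h : Realizable R) :
    ∃ (k m B : ℕ) (edge : Fin m → Fin k × Instr × Fin k) (a b : Fin k),
      (∀ t, (edge t).2.1.reg ≤ B) ∧
      ∀ s s', R s s' ↔ ReflTransGen (EdgeStep (Set.range edge)) (a, s) (b, s') := by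
  obtain ⟨Q, _, E, hE, a, b, hR⟩ := h
  obtain ⟨k, ⟨e⟩⟩ := Finite.exists_equiv_fin Q
  have := hE.to_subtype
  obtain ⟨m, ⟨f⟩⟩ := Finite.exists_equiv_fin E
  obtain ⟨B, hB⟩ := (hE.image fun x => x.2.1.reg).bddAbove
  have h1 : mapEdge e '' E ⊆ Set.range fun t => mapEdge e (f.symm t : Q × Instr × Q) := by
    rintro _ ⟨x, hx, rfl⟩
    exact ⟨f ⟨x, hx⟩, by simp⟩
  have h2 : mapEdge e.symm '' (Set.range fun t => mapEdge e (f.symm t : Q × Instr × Q)) ⊆ E := by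
    rintro _ ⟨_, ⟨t, rfl⟩, rfl⟩
    simp [mapEdge]
  refine ⟨k, m, B, fun t => mapEdge e (f.symm t), e a, e b,
    fun t => hB ⟨_, (f.symm t).2, rfl⟩, fun s s' => (hR s s').trans ⟨fun h => ?_, fun h => ?_⟩⟩
  · exact reach_mapEdge e h1 h
  · simpa using reach_mapEdge e.symm h2 h

/-- The domain of a partial recursive function is the set of the inputs for which a fixed marking
of a fixed net is coverable. -/
theorem exists_net_of_partrec {f : ℕ →. ℕ} (hf : Partrec f) :
    ∃ (k m B : ℕ) (edge : Fin m → Fin k × Instr × Fin k) (a b : Fin k), ∀ x,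
      (counterNet B edge a (update 0 0 x)).Coverable (marking B b fun _ => 0) ↔ (f x).Dom := by
  -- The input is in register 0, the output in register 1, and scratch space starts at 2.
  obtain ⟨R, hR, hR'⟩ := computes_of_partrec (Nat.Partrec'.part_iff₁.2 hf) (fun _ => 0) 1 2
    (by simp) (by simp) (by omega)
  obtain ⟨k, m, B, edge, a, b, hedge, h⟩ := hR.exists_edge
  refine ⟨k, m, B, edge, a, b, fun x => ?_⟩
  rw [counterNet_coverable_iff _ _ _ hedge]
  simp only [← h]
  have hc : Clean 2 (update 0 0 x) := fun r hr => by
    rw [update_of_ne (by omega)]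
    rfl
  simp only [hR' _ hc, update_self]
  constructor
  · rintro ⟨_, y, hy, -⟩
    exact Part.dom_iff_mem.2 ⟨y, by simpa [List.Vector.ofFn] using hy⟩
  · intro h
    obtain ⟨y, hy⟩ := Part.dom_iff_mem.1 h
    exact ⟨_, y, by simpa [List.Vector.ofFn] using hy, rfl⟩

/-- The arcs and the hierarchy do not depend on `x`; in the whole code `x` appears only as the first
entry of the initial marking. -/
theorem computable_coverCode {k m : ℕ} (B : ℕ) (edge : Fin m → Fin k × Instr × Fin k)
    (a : Fin k) (M : Fin (B + k + 1) → ℕ) :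
    Computable fun x => (counterNet B edge a (update 0 0 x)).coverCode M := by
  have h : ∀ x, List.ofFn (marking B a (update 0 0 x)) =
      x :: List.ofFn fun p : Fin (B + k) => marking B a (fun _ => 0) p.succ := by
    intro x
    rw [List.ofFn_succ]
    simp [marking]
  let c := (counterNet B edge a 0).coverCode M
  have hc : ∀ x, (counterNet B edge a (update 0 0 x)).coverCode M =
      (c.1, c.2.1, c.2.2.1, c.2.2.2.1, c.2.2.2.2.1,
        x :: List.ofFn (fun p : Fin (B + k) => marking B a (fun _ => 0) p.succ),
        c.2.2.2.2.2.2) := by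
    intro x
    rw [← h]
    rfl
  simp only [hc]
  exact .pair (.const _) (.pair (.const _) (.pair (.const _) (.pair (.const _) (.pair (.const _)
    (.pair (Computable.list_cons.comp .id (.const _)) (.const _))))))

end CounterMachine

/-- There is no algorithm that, given a Petri net with hierarchical inhibitor and transfer arcs and
a marking, decides whether the marking can be covered from the initial marking. -/
theorem corollary6 :
    ¬ ∃ decider : CoverCode → Bool, Computable decider ∧
      ∀ (n m : ℕ) (N : HITPN (Fin n) (Fin m)) (M : Fin n → ℕ),
        decider (N.coverCode M) = true ↔ N.Coverable M := by
  rintro ⟨decider, hd, h⟩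
  -- The universal function on input 0: its domain is the halting set, so one fixed automaton serves
  -- for all programs.
  have hf : Partrec fun x : ℕ => (Denumerable.ofNat Nat.Partrec.Code x).eval 0 :=
    Nat.Partrec.Code.eval_part.comp (Computable.ofNat _) (.const 0)
  obtain ⟨k, m, B, edge, a, b, hN⟩ := CounterMachine.exists_net_of_partrec hf
  refine ComputablePred.halting_problem 0 (ComputablePred.computable_iff.2
    ⟨fun c => decider ((CounterMachine.counterNet B edge a
      (Function.update 0 0 (Encodable.encode c))).coverCode
        (CounterMachine.marking B b fun _ => 0)),
      hd.comp ((CounterMachine.computable_coverCode B edge a _).comp Computable.encode), ?_⟩)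
  funext c
  simp [h, hN]
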